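/- For $n\ge 1$ let $B^n_2=\{x\in\mathbb{R}^n:\|x\|\le 1\}$ be the Euclidean unit ball, $B^n_\infty=\{x\in\mathbb{R}^n:\max_k|x^k|\le 1\}$ the cube, and $$W^{(1)}_n=\operatorname{conv}\left(\left(B^n_2\times\{0\}\right)\cup\left(\tfrac{1}{\sqrt n}B^n_\infty\times\{1\}\right)\right)\subset\mathbb{R}^n\times\mathbb{R}=\mathbb{R}^{n+1}.$$ Let $e_{n+1}=(0,\dots,0,1)$. An ellipsoid is the image of the closed Euclidean unit ball under an invertible affine map, and its centre is the image of the origin. The Löwner ellipsoid of a convex body $K$ is the ellipsoid of minimal volume among all ellipsoids containing $K$, and $l(K)$ denotes its centre. The centroid of $K\subset\mathbb{R}^{n+1}$ is $g(K)=\frac{1}{\operatorname{vol}_{n+1}(K)}\int_K x\,dx$, and $g^{n+1}(K)$ denotes its $(n+1)$-th coordinate. Then for every $n\ge 1$ the Löwner ellipsoid of $W^{(1)}_n$ exists and is unique, and $$l(W^{(1)}_n)=\tfrac12 e_{n+1},\qquad g(W^{(1)}_n)=g^{n+1}(W^{(1)}_n)\,e_{n+1}.$$ Moreover, as $n\to\infty$,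 $$g^{n+1}(W^{(1)}_n)=\frac1n\cdot\frac{1}{1-\sqrt{2/\pi}}+o\left(\frac1n\right).$$ -/

import Mathlib

open scoped Pointwise

noncomputable section

namespace AffinePoints

/-- `S` is a (nondegenerate) ellipsoid in `ℝᵐ` with centre `c`: the image of the closed Euclidean
unit ball under a map `x ↦ c + T x` with `T` linear and invertible. -/
def IsEllipsoidWithCentre {m : ℕ} (S : Set (EuclideanSpace ℝ (Fin m)))
    (c : EuclideanSpace ℝ (Fin m)) : Prop :=
  ∃ T : EuclideanSpace ℝ (Fin m) ≃ₗ[ℝ] EuclideanSpace ℝ (Fin m),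
    S = (fun x => c + T x) '' Metric.closedBall 0 1

/-- `S` is an ellipsoid in `ℝᵐ`. -/
def IsEllipsoid {m : ℕ} (S : Set (EuclideanSpace ℝ (Fin m))) : Prop :=
  ∃ c, IsEllipsoidWithCentre S c

/-- `L` is a Löwner ellipsoid of `K`: an ellipsoid containing `K`, of minimal volume among all
ellipsoids containing `K`. -/
def IsLoewnerEllipsoid {m : ℕ} (K L : Set (EuclideanSpace ℝ (Fin m))) : Prop :=
  IsEllipsoid L ∧ K ⊆ L ∧
    ∀ S, IsEllipsoid S → K ⊆ S → MeasureTheory.volume L ≤ MeasureTheory.volume S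

/-- `c` is the centre of a Löwner ellipsoid of `K`. -/
def IsLoewnerCentre {m : ℕ} (K : Set (EuclideanSpace ℝ (Fin m)))
    (c : EuclideanSpace ℝ (Fin m)) : Prop :=
  ∃ L, IsLoewnerEllipsoid K L ∧ IsEllipsoidWithCentre L c

/-- The centroid `vol(K)⁻¹ ∫_K x dx` of `K`. -/
def centroid {m : ℕ} (K : Set (EuclideanSpace ℝ (Fin m))) : EuclideanSpace ℝ (Fin m) :=
  (MeasureTheory.volume.real K)⁻¹ • ∫ x in K, x

/-- The cube `B^n_∞`. -/
def cube (n : ℕ) : Set (EuclideanSpace ℝ (Fin n)) := {x | ∀ k, |x k| ≤ 1}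

/-- The point `(x, t)` of `ℝⁿ × ℝ = ℝⁿ⁺¹`, the number `t` being the last coordinate. -/
def pair {n : ℕ} (x : EuclideanSpace ℝ (Fin n)) (t : ℝ) : EuclideanSpace ℝ (Fin (n + 1)) :=
  WithLp.toLp 2 (Fin.snoc (α := fun _ => ℝ) (fun i => x i) t)

/-- The last standard basis vector `e_{n+1}` of `ℝⁿ⁺¹`. -/
def eLast (n : ℕ) : EuclideanSpace ℝ (Fin (n + 1)) := EuclideanSpace.single (Fin.last n) 1

/-- `W_n = conv((B^n_2, 0), (n^{-1/2} B^n_∞, 1))`, a convex body in `ℝⁿ⁺¹`. -/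
def W (n : ℕ) : Set (EuclideanSpace ℝ (Fin (n + 1))) :=
  convexHull ℝ
    ((fun x => pair x 0) '' Metric.closedBall (0 : EuclideanSpace ℝ (Fin n)) 1 ∪
      (fun x => pair x 1) '' ((1 / √(n : ℝ)) • cube n))

end AffinePoints

end

namespace AffinePoints

open MeasureTheory Filter
open scoped Topology

/-! ### Löwner ellipsoid -/

/-! Löwner ellipsoid. Let `c + T B` contain `W n`, where `B` is the unit ball, and let `D` be
`loewnerMap`. Containment is tested only at points `(±e_i, 0)` and at cube vertices at height 1,
with signs chosen to make every cross term nonnegative. Averaging and the parallelogram law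
(`contact_inequality`) give `‖T⁻¹D‖²_HS + (n+1)‖T⁻¹(e/2 - c)‖² ≤ n+1`, with `e = eLast n`. If `c + T
B` has no more volume than `loewner`, then `|det T⁻¹D| ≥ 1`, and AM-GM for the eigenvalues of the
Gram matrix makes `T⁻¹D` orthogonal. Equality then forces `c = e/2` and the two ellipsoids coincide.
This rigidity (`eq_of_volume_le_loewner`) yields minimality, uniqueness and the centre together.

Centroid. The slice of `W n` at height `t` is the sum of a ball of radius `1 - t` and a cube of
half-side `t/√n`. Its volume is given by a Steiner formula, proved by pushing Lebesgue measure
forward under soft thresholding. Integrating over `t` produces Beta integrals that cancel the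
binomials, so with `a_k = mixedCoeff n k` the last coordinate of the centroid is `∑ (k+1) a_k /
((n+2) ∑ a_k)`. Log-convexity of Gamma gives `a_k / a_0 → q^k` with `q = √(2/π)`, and a geometric
bound permits passing to the limit: `∑ (k+1) q^k / ∑ q^k = 1/(1-q)`. The other coordinates vanish by
symmetry. -/

/-- A positive semidefinite matrix with trace at most its size and determinant at least `1` is the
identity. -/
lemma posSemidef_eq_one_of_trace_le_of_one_le_det {N : ℕ} {P : Matrix (Fin N) (Fin N) ℝ}
    (hP : P.PosSemidef) (htr : P.trace ≤ N) (hdet : 1 ≤ P.det) : P = 1 := by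
  have hH := hP.isHermitian
  have hprod : P.det = ∏ i, hH.eigenvalues i := by simpa using hH.det_eq_prod_eigenvalues
  have hsum : P.trace = ∑ i, hH.eigenvalues i := by simpa using hH.trace_eq_sum_eigenvalues
  have hpos : ∀ i, 0 < hH.eigenvalues i := fun i =>
    lt_of_le_of_ne (hP.eigenvalues_nonneg i) fun h0 => by
      rw [hprod, Finset.prod_eq_zero (Finset.mem_univ i) h0.symm] at hdet
      linarith
  have hlog : 0 ≤ ∑ i, Real.log (hH.eigenvalues i) := by
    rw [← Real.log_prod (fun i _ => (hpos i).ne'), ← hprod]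
    exact Real.log_nonneg hdet
  have hterm : ∀ i ∈ Finset.univ, 0 ≤ hH.eigenvalues i - 1 - Real.log (hH.eigenvalues i) :=
    fun i _ => by linarith [Real.log_le_sub_one_of_pos (hpos i)]
  -- The sum is `trace - N - log det ≤ 0`, while each term is nonnegative and vanishes only at
  -- eigenvalue 1.
  have hzero : ∑ i, (hH.eigenvalues i - 1 - Real.log (hH.eigenvalues i)) = 0 := by
    refine le_antisymm ?_ (Finset.sum_nonneg hterm)
    simp only [Finset.sum_sub_distrib, ← hsum]
    simp
    linarith
  have hone : hH.eigenvalues = fun _ => 1 := by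
    funext i
    by_contra hne
    have h1 := (Finset.sum_eq_zero_iff_of_nonneg hterm).1 hzero i (Finset.mem_univ i)
    linarith [Real.log_lt_sub_one_of_pos (hpos i) hne]
  rw [hH.spectral_theorem, hone]
  simp

/-- A linear map that does not shrink volumes and whose squared Hilbert–Schmidt norm is at most
the dimension is an isometry. -/
lemma norm_map_eq_of_sum_sq_le_of_one_le_abs_det {N : ℕ}
    (M : EuclideanSpace ℝ (Fin N) →ₗ[ℝ] EuclideanSpace ℝ (Fin N))
    (hs : ∑ i, ‖M (EuclideanSpace.single i 1)‖ ^ 2 ≤ N) (hdet : 1 ≤ |LinearMap.det M|)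
    (x : EuclideanSpace ℝ (Fin N)) : ‖M x‖ = ‖x‖ := by
  set b := (EuclideanSpace.basisFun (Fin N) ℝ) with hb
  set X := LinearMap.toMatrix b.toBasis b.toBasis M with hX
  have hXe : ∀ i j, X i j = M (EuclideanSpace.single j 1) i := fun i j => by
    simp [hX, hb, LinearMap.toMatrix_apply]
  have htrace : (X.transpose * X).trace = ∑ i, ‖M (EuclideanSpace.single i 1)‖ ^ 2 := by
    simp only [Matrix.trace, Matrix.diag, Matrix.mul_apply, Matrix.transpose_apply, hXe,
      EuclideanSpace.norm_sq_eq, Real.norm_eq_abs, sq_abs]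
    simp only [sq]
  have hXdet : X.det = LinearMap.det M := LinearMap.det_toMatrix _ _
  have hXX : X.transpose * X = 1 := by
    refine posSemidef_eq_one_of_trace_le_of_one_le_det ?_ (htrace ▸ hs) ?_
    · simpa using Matrix.posSemidef_conjTranspose_mul_self X
    · rw [Matrix.det_mul, Matrix.det_transpose, hXdet, ← abs_mul_abs_self]
      nlinarith
  have hMx : ∀ i, M x i = X.mulVec x i := fun i => by
    have := congrFun (LinearMap.toMatrix_mulVec_repr b.toBasis b.toBasis M x) i
    have hrepr : ⇑(b.toBasis.repr x) = x := by ext j; simp [hb]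
    rw [hrepr] at this
    simpa [hb] using this.symm
  have hsq : ‖M x‖ ^ 2 = ‖x‖ ^ 2 := by
    have h1 : ‖M x‖ ^ 2 = dotProduct (X.mulVec x) (X.mulVec x) := by
      simp only [EuclideanSpace.norm_sq_eq, Real.norm_eq_abs, sq_abs, hMx, dotProduct]
      simp only [sq]
    have h2 : ‖x‖ ^ 2 = dotProduct (⇑x) x := by
      simp only [EuclideanSpace.norm_sq_eq, Real.norm_eq_abs, sq_abs, dotProduct]
      simp only [sq]
    rw [h1, h2, Matrix.dotProduct_mulVec, ← Matrix.mulVec_transpose, Matrix.mulVec_mulVec, hXX,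
      Matrix.one_mulVec]
  exact (sq_eq_sq₀ (norm_nonneg _) (norm_nonneg _)).1 hsq

/-- Some choice of signs gives a signed sum at least as long as for orthogonal vectors. -/
lemma exists_signs_sum_sq_le {ι E : Type*} [NormedAddCommGroup E] [InnerProductSpace ℝ E]
    (s : Finset ι) (u : E) (v : ι → E) :
    ∃ ε : ι → ℝ, (∀ i, |ε i| ≤ 1) ∧
      ‖u‖ ^ 2 + ∑ i ∈ s, ‖v i‖ ^ 2 ≤ ‖u + ∑ i ∈ s, ε i • v i‖ ^ 2 := by
  classical
  induction s using Finset.induction_on with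
  | empty => exact ⟨fun _ => 0, by simp, by simp⟩
  | insert a s ha ih =>
    obtain ⟨ε, hε, h⟩ := ih
    set w := u + ∑ i ∈ s, ε i • v i with hw
    -- The sign of `⟪w, v a⟫` is taken, so that the cross term only helps.
    have key : ∃ δ : ℝ, |δ| ≤ 1 ∧ ‖w‖ ^ 2 + ‖v a‖ ^ 2 ≤ ‖w + δ • v a‖ ^ 2 := by
      rcases le_total 0 (inner ℝ w (v a)) with h0 | h0
      · refine ⟨1, by simp, ?_⟩
        rw [one_smul, norm_add_sq_real w]
        linarith
      · refine ⟨-1, by simp, ?_⟩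
        rw [neg_one_smul, ← sub_eq_add_neg, norm_sub_sq_real w]
        linarith
    obtain ⟨δ, hδ, hle⟩ := key
    refine ⟨Function.update ε a δ, fun i => ?_, ?_⟩
    · rcases eq_or_ne i a with rfl | hi
      · simpa using hδ
      · simpa [hi] using hε i
    · rw [Finset.sum_insert ha, Finset.sum_insert ha, Function.update_self]
      have : ∑ i ∈ s, Function.update ε a δ i • v i = ∑ i ∈ s, ε i • v i :=
        Finset.sum_congr rfl fun i hi => by
          rw [Function.update_of_ne (ne_of_mem_of_not_mem hi ha)]
      rw [this, add_comm (δ • v a), ← add_assoc u, ← hw]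
      linarith

@[simp] lemma pair_castSucc {n : ℕ} (x : EuclideanSpace ℝ (Fin n)) (t : ℝ) (i : Fin n) :
    pair x t i.castSucc = x i := by simp [pair]

@[simp] lemma pair_last {n : ℕ} (x : EuclideanSpace ℝ (Fin n)) (t : ℝ) :
    pair x t (Fin.last n) = t := by simp [pair]

lemma norm_sq_eq_sum_add {n : ℕ} (y : EuclideanSpace ℝ (Fin (n + 1))) :
    ‖y‖ ^ 2 = ∑ i : Fin n, y i.castSucc ^ 2 + y (Fin.last n) ^ 2 := by
  simp [EuclideanSpace.norm_sq_eq, Fin.sum_univ_castSucc]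

lemma pair_eq_sum {n : ℕ} (x : EuclideanSpace ℝ (Fin n)) (t : ℝ) :
    pair x t = t • eLast n + ∑ i, x i • EuclideanSpace.single i.castSucc (1 : ℝ) := by
  ext j
  refine Fin.lastCases ?_ (fun j => ?_) j
  · simp [eLast, (Fin.castSucc_ne_last _).symm]
  · simp [eLast, Pi.single_apply, Fin.castSucc_ne_last]

/-- The scalars of the diagonal map that defines the Löwner ellipsoid of `W n`. -/
noncomputable def loewnerScale (n : ℕ) : Fin (n + 1) → ℝ :=
  Fin.snoc (α := fun _ => ℝ) (fun _ => √((n + 1) / n)) (√(n + 1) / 2)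

lemma loewnerScale_pos {n : ℕ} (hn : 1 ≤ n) (i : Fin (n + 1)) : 0 < loewnerScale n i := by
  have : (0 : ℝ) < n := by exact_mod_cast hn
  refine Fin.lastCases ?_ (fun j => ?_) i
  · simp only [loewnerScale, Fin.snoc_last]; positivity
  · simp only [loewnerScale, Fin.snoc_castSucc]; positivity

/-- The diagonal map that defines the Löwner ellipsoid of `W n`. -/
noncomputable def loewnerMap {n : ℕ} (hn : 1 ≤ n) :
    EuclideanSpace ℝ (Fin (n + 1)) ≃ₗ[ℝ] EuclideanSpace ℝ (Fin (n + 1)) where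
  toFun x := WithLp.toLp 2 fun i => loewnerScale n i * x i
  invFun x := WithLp.toLp 2 fun i => (loewnerScale n i)⁻¹ * x i
  map_add' x y := by ext i; simp [mul_add]
  map_smul' a x := by ext i; simp [mul_left_comm]
  left_inv x := by ext i; simp [(loewnerScale_pos hn i).ne']
  right_inv x := by ext i; simp [(loewnerScale_pos hn i).ne']

/-- The Löwner ellipsoid of `W n`. -/
def loewner {n : ℕ} (hn : 1 ≤ n) : Set (EuclideanSpace ℝ (Fin (n + 1))) :=
  (fun x => (1 / 2 : ℝ) • eLast n + loewnerMap hn x) '' Metric.closedBall 0 1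

lemma loewnerMap_single {n : ℕ} (hn : 1 ≤ n) (i : Fin (n + 1)) :
    loewnerMap hn (EuclideanSpace.single i 1) = loewnerScale n i • EuclideanSpace.single i 1 := by
  ext j
  by_cases h : j = i
  · subst h; simp [loewnerMap]
  · simp [loewnerMap, h]

/-- With squared semi-axes `(n+1)/n` and `(n+1)/4`, the horizontal part contributes at most
`n/(n+1)` and the vertical part exactly `1/(n+1)`. Both generating pieces of `W n` meet the
hypotheses, at `t = 0` and `t = 1`. -/
lemma mem_loewner {n : ℕ} (hn : 1 ≤ n) (x : EuclideanSpace ℝ (Fin n)) (t : ℝ)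
    (hx : ‖x‖ ^ 2 ≤ 1) (ht : (t - 1 / 2) ^ 2 = 1 / 4) : pair x t ∈ loewner hn := by
  have hn0 : (0 : ℝ) < n := by exact_mod_cast hn
  refine ⟨(loewnerMap hn).symm (pair x t - (1 / 2 : ℝ) • eLast n), ?_, by simp⟩
  rw [mem_closedBall_zero_iff, ← sq_le_one_iff₀ (norm_nonneg _), norm_sq_eq_sum_add]
  have h1 : ∀ i : Fin n, (loewnerMap hn).symm (pair x t - (1 / 2 : ℝ) • eLast n) i.castSucc ^ 2
      = n / (n + 1) * x i ^ 2 := fun i => by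
    have : (loewnerMap hn).symm (pair x t - (1 / 2 : ℝ) • eLast n) i.castSucc
        = (√((n + 1) / n))⁻¹ * x i := by
      simp [loewnerMap, loewnerScale, eLast, Fin.castSucc_ne_last]
    rw [this, mul_pow, inv_pow, Real.sq_sqrt (by positivity), inv_div]
  have h2 : (loewnerMap hn).symm (pair x t - (1 / 2 : ℝ) • eLast n) (Fin.last n) ^ 2
      = 1 / (n + 1) := by
    have : (loewnerMap hn).symm (pair x t - (1 / 2 : ℝ) • eLast n) (Fin.last n)
        = (√(n + 1) / 2)⁻¹ * (t - 1 / 2) := by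
      simp [loewnerMap, loewnerScale, eLast]
    rw [this, mul_pow, inv_pow, div_pow, Real.sq_sqrt (by positivity), ht]
    field_simp
    norm_num
  simp only [h1, h2, ← Finset.mul_sum]
  have h3 : ∑ i, x i ^ 2 ≤ 1 := by simpa [EuclideanSpace.norm_sq_eq] using hx
  calc (n / (n + 1) : ℝ) * ∑ i, x i ^ 2 + 1 / (n + 1) ≤ n / (n + 1) * 1 + 1 / (n + 1) := by gcongr
    _ = 1 := by field_simp

lemma mem_smul_cube_iff {n : ℕ} (hn : 1 ≤ n) (x : EuclideanSpace ℝ (Fin n)) :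
    x ∈ (1 / √(n : ℝ)) • cube n ↔ ∀ i, |x i| ≤ 1 / √n := by
  have hs : 0 < √(n : ℝ) := Real.sqrt_pos.2 (by exact_mod_cast hn)
  rw [Set.mem_smul_set_iff_inv_smul_mem₀ (by positivity)]
  simp only [cube, Set.mem_ofPred_eq, PiLp.smul_apply, smul_eq_mul, abs_mul, one_div, inv_inv,
    abs_of_pos hs]
  simp only [inv_eq_one_div, le_div_iff₀' hs]

lemma W_subset_loewner {n : ℕ} (hn : 1 ≤ n) : W n ⊆ loewner hn := by
  refine convexHull_min ?_ ?_
  · rintro _ (⟨x, hx, rfl⟩ | ⟨x, hx, rfl⟩)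
    · refine mem_loewner hn x 0 ?_ (by norm_num)
      rw [mem_closedBall_zero_iff] at hx
      exact pow_le_one₀ (norm_nonneg _) hx
    · refine mem_loewner hn x 1 ?_ (by norm_num)
      rw [mem_smul_cube_iff hn] at hx
      have hn0 : (0 : ℝ) < n := by exact_mod_cast hn
      have : ∀ i ∈ Finset.univ, ‖x i‖ ^ 2 ≤ (1 / n : ℝ) := fun i _ => by
        calc (‖x i‖ ^ 2 : ℝ) ≤ (1 / √n) ^ 2 := by gcongr; exact hx i
          _ = (1 / n : ℝ) := by rw [div_pow, Real.sq_sqrt hn0.le, one_pow]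
      rw [EuclideanSpace.norm_sq_eq]
      refine (Finset.sum_le_sum this).trans ?_
      simp [hn0.ne']
  · rw [loewner, ← Set.image_image (fun y => (1 / 2 : ℝ) • eLast n + y) (loewnerMap hn)]
    rw [Set.image_add_left]
    exact ((convex_closedBall _ _).linear_image (loewnerMap hn).toLinearMap).translate_preimage_right _

lemma volume_affine_image {m : ℕ} (c : EuclideanSpace ℝ (Fin m))
    (T : EuclideanSpace ℝ (Fin m) ≃ₗ[ℝ] EuclideanSpace ℝ (Fin m)) :
    volume ((fun x => c + T x) '' Metric.closedBall 0 1) =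
      ENNReal.ofReal |LinearMap.det T.toLinearMap| *
        volume (Metric.closedBall (0 : EuclideanSpace ℝ (Fin m)) 1) := by
  rw [← Set.image_image (fun y => c + y) T, Set.image_add_left, measure_preimage_add]
  exact Measure.addHaar_image_linearMap volume T.toLinearMap _

lemma abs_det_le_of_volume_le {m : ℕ} {c d : EuclideanSpace ℝ (Fin m)}
    {S T : EuclideanSpace ℝ (Fin m) ≃ₗ[ℝ] EuclideanSpace ℝ (Fin m)}
    (h : volume ((fun x => c + S x) '' Metric.closedBall 0 1) ≤
      volume ((fun x => d + T x) '' Metric.closedBall 0 1)) :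
    |LinearMap.det S.toLinearMap| ≤ |LinearMap.det T.toLinearMap| := by
  rw [volume_affine_image, volume_affine_image, ENNReal.mul_le_mul_iff_left
    (Metric.measure_closedBall_pos volume _ one_pos).ne' measure_closedBall_lt_top.ne,
    ENNReal.ofReal_le_ofReal_iff (abs_nonneg _)] at h
  exact h

/-- The averaged containment inequality, over the contact points of the Löwner ellipsoid. -/
lemma contact_inequality {n : ℕ} (hn : 1 ≤ n) {c : EuclideanSpace ℝ (Fin (n + 1))}
    {T : EuclideanSpace ℝ (Fin (n + 1)) ≃ₗ[ℝ] EuclideanSpace ℝ (Fin (n + 1))}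
    (hW : W n ⊆ (fun x => c + T x) '' Metric.closedBall 0 1) :
    (1 / n : ℝ) * ∑ i : Fin n, ‖T.symm (EuclideanSpace.single i.castSucc 1)‖ ^ 2
      + 1 / 4 * ‖T.symm (eLast n)‖ ^ 2 + ‖T.symm ((1 / 2 : ℝ) • eLast n - c)‖ ^ 2 ≤ 1 := by
  have hn0 : (0 : ℝ) < n := by exact_mod_cast hn
  have hA : ∀ w ∈ W n, ‖T.symm (w - c)‖ ^ 2 ≤ 1 := by
    intro w hw
    obtain ⟨x, hx, rfl⟩ := hW hw
    simpa using hx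
  set u₀ := T.symm (-c) with hu₀
  set u₁ := T.symm (eLast n - c) with hu₁
  set v : Fin n → _ := fun i => T.symm (EuclideanSpace.single i.castSucc 1) with hv
  have h0 : ∀ i, ‖u₀‖ ^ 2 + ‖v i‖ ^ 2 ≤ 1 := by
    intro i
    obtain ⟨ε, hε, h⟩ := exists_signs_sum_sq_le {i} u₀ v
    simp only [Finset.sum_singleton] at h
    refine h.trans ?_
    have hmem : pair (EuclideanSpace.single i (ε i)) 0 ∈ W n :=
      subset_convexHull _ _ (Or.inl ⟨_, by simpa using hε i, rfl⟩)
    have := hA _ hmem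
    rw [pair_eq_sum] at this
    simpa [hu₀, hv, Pi.single_apply, sub_eq_neg_add] using this
  have h1 : ‖u₁‖ ^ 2 + 1 / n * ∑ i, ‖v i‖ ^ 2 ≤ 1 := by
    obtain ⟨ε, hε, h⟩ := exists_signs_sum_sq_le Finset.univ u₁ fun i => (1 / √(n : ℝ)) • v i
    have hn1 : ∑ i, ‖(1 / √(n : ℝ)) • v i‖ ^ 2 = 1 / n * ∑ i, ‖v i‖ ^ 2 := by
      simp [norm_smul, mul_pow, Finset.mul_sum, Real.sq_sqrt hn0.le]
    rw [hn1] at h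
    refine h.trans ?_
    have hmem : pair (WithLp.toLp 2 fun i => (1 / √(n : ℝ)) * ε i) 1 ∈ W n := by
      refine subset_convexHull _ _ (Or.inr ⟨_, (mem_smul_cube_iff hn _).2 fun i => ?_, rfl⟩)
      have : |1 / √(n : ℝ)| = 1 / √n := abs_of_nonneg (by positivity)
      simp only [abs_mul, this]
      exact mul_le_of_le_one_right (by positivity) (hε i)
    have := hA _ hmem
    rw [pair_eq_sum, one_smul, add_sub_right_comm, map_add] at this
    simpa [hu₁, hv, smul_smul, mul_comm] using this
  have h0' : ‖u₀‖ ^ 2 + 1 / n * ∑ i, ‖v i‖ ^ 2 ≤ 1 := by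
    have := Finset.sum_le_sum fun i (_ : i ∈ Finset.univ) => h0 i
    simp only [Finset.sum_add_distrib, Finset.sum_const, Finset.card_univ, Fintype.card_fin,
      nsmul_eq_mul, mul_one] at this
    have h2 := mul_le_mul_of_nonneg_left this (by positivity : (0 : ℝ) ≤ 1 / n)
    rw [mul_add, ← mul_assoc, one_div_mul_cancel hn0.ne', one_mul] at h2
    exact h2
  -- The mean of `h0'` and `h1` is the claim: `(‖u₁‖² + ‖u₀‖²)/2 = ‖(u₁ + u₀)/2‖² + ‖u₁ - u₀‖²/4`.
  have hpar := parallelogram_law_with_norm ℝ u₁ u₀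
  have hsub : u₁ - u₀ = T.symm (eLast n) := by rw [hu₁, hu₀, ← map_sub]; congr 1; abel
  have hadd : T.symm ((1 / 2 : ℝ) • eLast n - c) = (1 / 2 : ℝ) • (u₁ + u₀) := by
    rw [hu₁, hu₀, ← map_add, ← map_smul]
    congr 1
    module
  rw [hadd, ← hsub, norm_smul, mul_pow]
  norm_num
  simp only [← one_div]
  nlinarith

/-- The contact inequality bounds the Hilbert–Schmidt norm of `M = T⁻¹D`, and the volume hypothesis
bounds its determinant from below, so `M` is an isometry. Its squared Hilbert–Schmidt norm is then
exactly `n + 1`, which leaves no room for the term containing `c`. -/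
lemma eq_of_volume_le_loewner {n : ℕ} (hn : 1 ≤ n) {c : EuclideanSpace ℝ (Fin (n + 1))}
    {T : EuclideanSpace ℝ (Fin (n + 1)) ≃ₗ[ℝ] EuclideanSpace ℝ (Fin (n + 1))}
    (hW : W n ⊆ (fun x => c + T x) '' Metric.closedBall 0 1)
    (hvol : volume ((fun x => c + T x) '' Metric.closedBall 0 1) ≤ volume (loewner hn)) :
    c = (1 / 2 : ℝ) • eLast n ∧ (fun x => c + T x) '' Metric.closedBall 0 1 = loewner hn := by
  have hn0 : (0 : ℝ) < n := by exact_mod_cast hn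
  have hdet := abs_det_le_of_volume_le hvol
  have hc := contact_inequality hn hW
  set M := (loewnerMap hn).trans T.symm with hM
  have hsum : ∑ i, ‖M (EuclideanSpace.single i 1)‖ ^ 2 = (n + 1) *
      ((1 / n : ℝ) * ∑ i : Fin n, ‖T.symm (EuclideanSpace.single i.castSucc 1)‖ ^ 2
        + 1 / 4 * ‖T.symm (eLast n)‖ ^ 2) := by
    have : (0 : ℝ) ≤ (n + 1) / n := by positivity
    have h' : (0 : ℝ) ≤ n + 1 := by positivity
    simp only [Fin.sum_univ_castSucc, hM, LinearEquiv.trans_apply, loewnerMap_single, map_smul,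
      norm_smul, mul_pow, loewnerScale, Fin.snoc_castSucc, Fin.snoc_last, ← Finset.mul_sum,
      Real.norm_eq_abs, sq_abs, div_pow, Real.sq_sqrt this, Real.sq_sqrt h', eLast]
    ring
  have hMdet : 1 ≤ |LinearMap.det M.toLinearMap| := by
    have h1 : LinearMap.det T.toLinearMap * LinearMap.det M.toLinearMap
        = LinearMap.det (loewnerMap hn).toLinearMap := by
      rw [← LinearMap.det_comp]
      congr 1
      ext x : 1
      simp [hM]
    have h2 : 0 < |LinearMap.det T.toLinearMap| := abs_pos.2 (LinearEquiv.isUnit_det' T).ne_zero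
    rw [← h1, abs_mul] at hdet
    nlinarith
  have hiso := norm_map_eq_of_sum_sq_le_of_one_le_abs_det M.toLinearMap (by
    push_cast
    refine hsum.trans_le ?_
    nlinarith [sq_nonneg ‖T.symm ((1 / 2 : ℝ) • eLast n - c)‖]) hMdet
  have hc0 : c = (1 / 2 : ℝ) • eLast n := by
    have h1 : ∑ i, ‖M (EuclideanSpace.single i 1)‖ ^ 2 = n + 1 := by
      have : ∀ i, ‖M (EuclideanSpace.single i 1)‖ = 1 := fun i => by
        have := hiso (EuclideanSpace.single i 1)
        simpa using this
      simp [this]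
    rw [h1] at hsum
    have h2 := mul_left_cancel₀ (by positivity : (n + 1 : ℝ) ≠ 0) ((mul_one _).trans hsum)
    have h3 : ‖T.symm ((1 / 2 : ℝ) • eLast n - c)‖ ^ 2 ≤ 0 := by linarith
    have h4 : T.symm ((1 / 2 : ℝ) • eLast n - c) = 0 := by
      simpa using le_antisymm h3 (sq_nonneg _)
    have h5 := (LinearEquiv.map_eq_zero_iff _).1 h4
    exact (sub_eq_zero.1 h5).symm
  refine ⟨hc0, ?_⟩
  have hiso' : ∀ x, ‖T.symm (loewnerMap hn x)‖ = ‖x‖ := hiso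
  rw [loewner, hc0]
  ext y
  constructor
  · rintro ⟨x, hx, rfl⟩
    refine ⟨M.symm x, ?_, by simp [hM]⟩
    rw [mem_closedBall_zero_iff] at hx ⊢
    rw [← hiso]
    simpa using hx
  · rintro ⟨x, hx, rfl⟩
    refine ⟨M x, ?_, by simp [hM]⟩
    rw [mem_closedBall_zero_iff] at hx ⊢
    exact (hiso x).trans_le hx

lemma isLoewnerEllipsoid_loewner {n : ℕ} (hn : 1 ≤ n) : IsLoewnerEllipsoid (W n) (loewner hn) := by
  refine ⟨⟨_, _, rfl⟩, W_subset_loewner hn, ?_⟩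
  rintro S ⟨c, T, rfl⟩ hW
  rcases le_total (volume (loewner hn)) (volume ((fun x => c + T x) '' Metric.closedBall 0 1))
    with h | h
  · exact h
  · exact ((eq_of_volume_le_loewner hn hW h).2 ▸ le_rfl)

lemma existsUnique_isLoewnerEllipsoid {n : ℕ} (hn : 1 ≤ n) :
    ∃! L, IsLoewnerEllipsoid (W n) L := by
  refine ⟨loewner hn, isLoewnerEllipsoid_loewner hn, ?_⟩
  rintro L ⟨⟨c, T, rfl⟩, hW, hmin⟩
  exact (eq_of_volume_le_loewner hn hW (hmin _ ⟨_, _, rfl⟩ (W_subset_loewner hn))).2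

lemma isLoewnerCentre_iff {n : ℕ} (hn : 1 ≤ n) (c : EuclideanSpace ℝ (Fin (n + 1))) :
    IsLoewnerCentre (W n) c ↔ c = (1 / 2 : ℝ) • eLast n := by
  constructor
  · rintro ⟨L, ⟨-, hW, hmin⟩, T, rfl⟩
    exact (eq_of_volume_le_loewner hn hW (hmin _ ⟨_, _, rfl⟩ (W_subset_loewner hn))).1
  · rintro rfl
    exact ⟨_, isLoewnerEllipsoid_loewner hn, _, rfl⟩

/-! ### Volumes of Minkowski sums of a ball and a cube -/

/-- Soft thresholding: the displacement from `[-r, r]` to `x`. -/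
noncomputable def shrink (r x : ℝ) : ℝ := x - max (-r) (min r x)

lemma continuous_shrink : Continuous fun p : ℝ × ℝ => shrink p.1 p.2 := by
  unfold shrink; fun_prop

@[fun_prop]
lemma measurable_shrink (r : ℝ) : Measurable (shrink r) := by
  unfold shrink; fun_prop

lemma shrink_of_lt_neg {r x : ℝ} (hr : 0 ≤ r) (h : x < -r) : shrink r x = x + r := by
  rw [shrink, min_eq_right (by linarith), max_eq_left h.le, sub_neg_eq_add]

lemma shrink_of_lt {r x : ℝ} (hr : 0 ≤ r) (h : r < x) : shrink r x = x - r := by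
  rw [shrink, min_eq_left h.le, max_eq_right (by linarith)]

lemma shrink_of_abs_le {r x : ℝ} (h : |x| ≤ r) : shrink r x = 0 := by
  rw [abs_le] at h
  rw [shrink, min_eq_right h.2, max_eq_right h.1, sub_self]

lemma abs_sub_shrink_le {r : ℝ} (hr : 0 ≤ r) (x : ℝ) : |x - shrink r x| ≤ r := by
  rw [shrink, sub_sub_cancel, abs_le]
  exact ⟨le_max_left _ _, max_le (by linarith) (min_le_left _ _)⟩

/-- Soft thresholding realises the distance from `x` to `[-r, r]`. This minimality, applied
coordinatewise, describes ball-plus-cube as a sublevel set of `∑ shrink²`. -/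
lemma abs_shrink_le {r x : ℝ} {a : ℝ} (hr : 0 ≤ r) (ha : |x - a| ≤ r) : |shrink r x| ≤ |a| := by
  rw [abs_le] at ha
  rcases lt_or_ge x (-r) with h | h
  · rw [shrink_of_lt_neg hr h, abs_of_neg (by linarith), abs_of_neg (by linarith)]
    linarith
  rcases lt_or_ge r x with h' | h'
  · rw [shrink_of_lt hr h', abs_of_pos (by linarith), abs_of_pos (by linarith)]
    linarith
  rw [shrink_of_abs_le (abs_le.2 ⟨h, h'⟩), abs_zero]
  exact abs_nonneg a

open scoped ENNReal in
/-- Soft thresholding pushes Lebesgue measure forward to Lebesgue measure plus an atom at `0`. -/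
lemma lintegral_comp_shrink {r : ℝ} (hr : 0 ≤ r) {φ : ℝ → ℝ≥0∞} (hφ : Measurable φ) :
    ∫⁻ u, φ (shrink r u) = (∫⁻ u, φ u) + ENNReal.ofReal (2 * r) * φ 0 := by
  have h1 : ∀ u, φ (shrink r u) = (Set.Iio (0 : ℝ)).indicator φ (u + r) +
      (Set.Ioi (0 : ℝ)).indicator φ (u - r) + (Set.Icc (-r) r).indicator (fun _ => φ 0) u := by
    intro u
    rcases lt_or_ge u (-r) with h | h
    · rw [Set.indicator_of_mem (by simp; linarith), Set.indicator_of_notMem (by simp; linarith),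
        Set.indicator_of_notMem (by simp [h]), shrink_of_lt_neg hr h]
      simp
    rcases lt_or_ge r u with h' | h'
    · rw [Set.indicator_of_notMem (by simp; linarith), Set.indicator_of_mem (by simp; linarith),
        Set.indicator_of_notMem (by simp [h']), shrink_of_lt hr h']
      simp
    · rw [Set.indicator_of_notMem (by simp; linarith), Set.indicator_of_notMem (by simp; linarith),
        Set.indicator_of_mem (by simp [h, h']), shrink_of_abs_le (abs_le.2 ⟨h, h'⟩)]
      simp
  have hm1 : Measurable ((Set.Iio (0 : ℝ)).indicator φ) := hφ.indicator measurableSet_Iio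
  have hm2 : Measurable ((Set.Ioi (0 : ℝ)).indicator φ) := hφ.indicator measurableSet_Ioi
  -- The two open half-lines miss only the null set `{0}`.
  have h2 : ∫⁻ u, φ u = ∫⁻ u, ((Set.Iio (0 : ℝ)).indicator φ u + (Set.Ioi (0 : ℝ)).indicator φ u) := by
    refine lintegral_congr_ae ?_
    filter_upwards [compl_mem_ae_iff.2 (measure_singleton (μ := volume) (0 : ℝ))] with u hu
    rcases lt_or_gt_of_ne (show u ≠ 0 from hu) with h | h
    · simp [h, h.le]
    · simp [h, h.le]
  simp_rw [h1]
  rw [lintegral_add_right _ (measurable_const.indicator measurableSet_Icc),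
    lintegral_add_right _ (by fun_prop), h2, lintegral_add_right _ hm2,
    lintegral_add_right_eq_self ((Set.Iio (0 : ℝ)).indicator φ),
    lintegral_sub_right_eq_self ((Set.Ioi (0 : ℝ)).indicator φ),
    lintegral_indicator_const measurableSet_Icc, Real.volume_Icc, mul_comm (φ 0)]
  congr 3
  ring

/-- Volume of a sublevel set of a separable function, sliced along the first coordinate. -/
lemma volume_sum_le_succ {h : ℝ → ℝ} (hh : Measurable h) (n : ℕ) (ρ : ℝ) :
    volume {y : Fin (n + 1) → ℝ | ∑ i, h (y i) ≤ ρ} =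
      ∫⁻ u, volume {z : Fin n → ℝ | ∑ i, h (z i) ≤ ρ - h u} := by
  have hS : MeasurableSet {p : ℝ × (Fin n → ℝ) | ∑ i, h (p.2 i) ≤ ρ - h p.1} :=
    measurableSet_le (by fun_prop) (by fun_prop)
  have hpre : {y : Fin (n + 1) → ℝ | ∑ i, h (y i) ≤ ρ} =
      MeasurableEquiv.piFinSuccAbove (fun _ => ℝ) 0 ⁻¹'
        {p : ℝ × (Fin n → ℝ) | ∑ i, h (p.2 i) ≤ ρ - h p.1} := by
    ext y
    simp only [Set.mem_ofPred_eq, Set.mem_preimage, Fin.sum_univ_succ, le_sub_iff_add_le']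
    rfl
  rw [hpre, (volume_preserving_piFinSuccAbove (fun _ : Fin (n + 1) => ℝ) 0).measure_preimage_equiv]
  exact Measure.prod_apply hS

/-- Volume of the unit ball of `ℝᵐ`. -/
noncomputable def ballVolume (m : ℕ) : ℝ := √Real.pi ^ m / Real.Gamma (m / 2 + 1)

lemma ballVolume_pos (m : ℕ) : 0 < ballVolume m := by
  have : 0 < Real.Gamma (m / 2 + 1) := Real.Gamma_pos_of_pos (by positivity)
  have := Real.pi_pos
  unfold ballVolume
  positivity

lemma volume_sum_sq_le (m : ℕ) {R : ℝ} (hR : 0 ≤ R) :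
    volume {z : Fin m → ℝ | ∑ i, z i ^ 2 ≤ R ^ 2} = ENNReal.ofReal (ballVolume m * R ^ m) := by
  rcases Nat.eq_zero_or_pos m with rfl | hm
  · have : {z : Fin 0 → ℝ | ∑ i, z i ^ 2 ≤ R ^ 2} = Set.univ := by ext z; simp [sq_nonneg]
    rw [this]
    simp [ballVolume, volume_pi]
  · have : Nonempty (Fin m) := ⟨⟨0, hm⟩⟩
    have h := EuclideanSpace.volume_closedBall (Fin m) 0 R
    rw [← (PiLp.volume_preserving_toLp (Fin m)).measure_preimage
      measurableSet_closedBall.nullMeasurableSet, Fintype.card_fin, ← ENNReal.ofReal_pow hR,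
      ← ENNReal.ofReal_mul (by positivity), mul_comm] at h
    rw [← ballVolume.eq_1] at h
    rw [← h]
    congr 1
    ext z
    rw [Set.mem_preimage, mem_closedBall_zero_iff, ← sq_le_sq₀ (norm_nonneg _) hR,
      EuclideanSpace.norm_sq_eq]
    simp

/-- Each coordinate carries Lebesgue measure plus an atom of mass `2r` at 0; picking the atom in `i`
coordinates leaves a ball in the other `n - i`. The level `ρ` is arbitrary, possibly negative,
because slicing replaces it by `ρ - v²`. -/
lemma volume_sum_shrink_le {r : ℝ} (hr : 0 ≤ r) (n : ℕ) (ρ : ℝ) :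
    volume {y : Fin n → ℝ | ∑ i, shrink r (y i) ^ 2 ≤ ρ} =
      ∑ ij ∈ Finset.HasAntidiagonal.antidiagonal n, n.choose ij.1 •
        (ENNReal.ofReal (2 * r) ^ ij.1 * volume {z : Fin ij.2 → ℝ | ∑ i, z i ^ 2 ≤ ρ}) := by
  have hmeas : ∀ m : ℕ, Measurable fun ρ : ℝ => volume {z : Fin m → ℝ | ∑ i, z i ^ 2 ≤ ρ} :=
    fun m => Monotone.measurable fun a b hab => measure_mono fun z hz => le_trans hz hab
  induction n generalizing ρ with
  | zero => simp
  | succ n ih =>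
    rw [volume_sum_le_succ (h := fun x => shrink r x ^ 2) (by fun_prop)]
    rw [lintegral_comp_shrink hr
      (φ := fun v => volume {z : Fin n → ℝ | ∑ i, shrink r (z i) ^ 2 ≤ ρ - v ^ 2})]
    · simp only [ih]
      rw [lintegral_finsetSum]
      · rw [Finset.sum_antidiagonal_choose_succ_nsmul (fun i j => ENNReal.ofReal (2 * r) ^ i *
          volume {z : Fin j → ℝ | ∑ k, z k ^ 2 ≤ ρ})]
        congr 1
        · refine Finset.sum_congr rfl fun ij _ => ?_
          rw [volume_sum_le_succ (h := fun x => x ^ 2) (by fun_prop)]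
          simp only [nsmul_eq_mul]
          have : Measurable fun u : ℝ => volume {z : Fin ij.2 → ℝ | ∑ i, z i ^ 2 ≤ ρ - u ^ 2} :=
            (hmeas ij.2).comp (f := fun u : ℝ => ρ - u ^ 2) (by fun_prop)
          rw [← lintegral_const_mul _ this, ← lintegral_const_mul]
          exact this.const_mul _
        · rw [Finset.mul_sum]
          refine Finset.sum_congr rfl fun ij hij => ?_
          rw [← Finset.HasAntidiagonal.mem_antidiagonal.1 hij, Nat.choose_symm_add]
          simp only [nsmul_eq_mul, pow_succ]
          simp
          ring
      · intro ij _
        have := (hmeas ij.2).comp (f := fun u : ℝ => ρ - u ^ 2) (by fun_prop)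
        simp only [nsmul_eq_mul]
        exact (this.const_mul _).const_mul _
    · simp only [ih, nsmul_eq_mul]
      refine Finset.measurable_sum _ fun ij _ => ?_
      have := (hmeas ij.2).comp (f := fun u : ℝ => ρ - u ^ 2) (by fun_prop)
      exact (this.const_mul _).const_mul _

/-- Steiner formula for the sum of a ball of radius `R` and the cube `[-r, r]ⁿ`. -/
lemma volume_sum_shrink_le_sq {r R : ℝ} (hr : 0 ≤ r) (hR : 0 ≤ R) (n : ℕ) :
    volume {y : Fin n → ℝ | ∑ i, shrink r (y i) ^ 2 ≤ R ^ 2} =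
      ENNReal.ofReal (∑ ij ∈ Finset.HasAntidiagonal.antidiagonal n,
        n.choose ij.1 * ((2 * r) ^ ij.1 * (ballVolume ij.2 * R ^ ij.2))) := by
  have hpos : ∀ j, 0 ≤ ballVolume j := fun j => (ballVolume_pos j).le
  rw [volume_sum_shrink_le hr, ENNReal.ofReal_sum_of_nonneg]
  · refine Finset.sum_congr rfl fun ij _ => ?_
    have := hpos ij.2
    rw [volume_sum_sq_le _ hR, ENNReal.ofReal_mul (Nat.cast_nonneg _), ENNReal.ofReal_natCast,
      ENNReal.ofReal_mul (p := (2 * r) ^ ij.1) (by positivity),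
      ENNReal.ofReal_pow (by positivity), nsmul_eq_mul]
  · intro ij _
    have := hpos ij.2
    positivity

/-- Integration by parts: `t^(a+1) (1-t)^(b+1)` vanishes at both endpoints, which trades a power of
`1 - t` for one of `t`. -/
lemma integral_pow_mul_one_sub_pow (a b : ℕ) :
    ∫ t in (0 : ℝ)..1, t ^ a * (1 - t) ^ b = a.factorial * b.factorial / (a + b + 1).factorial := by
  induction b generalizing a with
  | zero =>
    simp [integral_pow, Nat.factorial_succ]
    field_simp
  | succ b ih =>
    have hd : ∀ t ∈ Set.uIcc (0 : ℝ) 1, HasDerivAt (fun t : ℝ => t ^ (a + 1) * (1 - t) ^ (b + 1))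
        ((a + 1) * (t ^ a * (1 - t) ^ (b + 1)) - (b + 1) * (t ^ (a + 1) * (1 - t) ^ b)) t := by
      intro t _
      have h1 := (hasDerivAt_id t).pow (a + 1)
      have h2 := ((hasDerivAt_id t).const_sub 1).pow (b + 1)
      refine (h1.mul h2).congr_deriv ?_
      simp
      ring
    have h := intervalIntegral.integral_eq_sub_of_hasDerivAt hd
      (Continuous.intervalIntegrable (by fun_prop) _ _)
    rw [intervalIntegral.integral_sub (Continuous.intervalIntegrable (by fun_prop) _ _)
      (Continuous.intervalIntegrable (by fun_prop) _ _), intervalIntegral.integral_const_mul,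
      intervalIntegral.integral_const_mul, ih] at h
    have ha : (a + 1 : ℝ) ≠ 0 := by positivity
    have h' : ∫ t in (0 : ℝ)..1, t ^ a * (1 - t) ^ (b + 1) =
        (b + 1) * ((a + 1).factorial * b.factorial / (a + 1 + b + 1).factorial) / (a + 1) := by
      rw [eq_div_iff ha]
      simp at h
      linarith
    rw [h', show a + 1 + b + 1 = a + (b + 1) + 1 by ring, Nat.factorial_succ a,
      Nat.factorial_succ b]
    push_cast
    field_simp

/-! ### Volume and centroid of `W n` -/

lemma convex_cube (n : ℕ) : Convex ℝ (cube n) := by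
  have : cube n = ⋂ k, (fun x : EuclideanSpace ℝ (Fin n) => x k) ⁻¹' Set.Icc (-1) 1 := by
    ext x; simp [cube, abs_le]
  rw [this]
  exact convex_iInter fun k =>
    (convex_Icc (-1 : ℝ) 1).linear_preimage (EuclideanSpace.proj (𝕜 := ℝ) k).toLinearMap

lemma smul_pair_add_smul_pair {n : ℕ} (a b s t : ℝ) (x y : EuclideanSpace ℝ (Fin n)) :
    a • pair x s + b • pair y t = pair (a • x + b • y) (a * s + b * t) := by
  ext j
  refine Fin.lastCases ?_ (fun j => ?_) j <;> simp

lemma convex_image_pair {n : ℕ} {s : Set (EuclideanSpace ℝ (Fin n))} (hs : Convex ℝ s) (t : ℝ) :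
    Convex ℝ ((fun x => pair x t) '' s) := by
  rintro _ ⟨x, hx, rfl⟩ _ ⟨y, hy, rfl⟩ a b ha hb hab
  refine ⟨a • x + b • y, hs hx hy ha hb hab, ?_⟩
  simp only [smul_pair_add_smul_pair]
  rw [← add_mul, hab, one_mul]

/-- The slices of `W n` are sums of a ball and a cube. -/
lemma mem_W_iff {n : ℕ} (hn : 1 ≤ n) (w : EuclideanSpace ℝ (Fin (n + 1))) :
    w ∈ W n ↔ w (Fin.last n) ∈ Set.Icc (0 : ℝ) 1 ∧
      ∑ i : Fin n, shrink (w (Fin.last n) / √n) (w i.castSucc) ^ 2 ≤ (1 - w (Fin.last n)) ^ 2 := by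
  have hs : 0 < √(n : ℝ) := Real.sqrt_pos.2 (by exact_mod_cast hn)
  have h0 : (0 : EuclideanSpace ℝ (Fin n)) ∈ (1 / √(n : ℝ)) • cube n := by
    rw [mem_smul_cube_iff hn]; intro i; simp
  rw [W, Convex.convexHull_union (convex_image_pair (convex_closedBall _ _) _)
    (convex_image_pair ((convex_cube n).smul _) _)
    ⟨_, 0, by simp, rfl⟩ ⟨_, 0, h0, rfl⟩, mem_convexJoin]
  constructor
  · rintro ⟨_, ⟨x, hx, rfl⟩, _, ⟨y, hy, rfl⟩, a, t, ha, ht, hat, rfl⟩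
    obtain rfl : a = 1 - t := by linarith
    rw [mem_smul_cube_iff hn] at hy
    rw [mem_closedBall_zero_iff] at hx
    simp only [smul_pair_add_smul_pair, pair_last, pair_castSucc, mul_zero, zero_add, mul_one]
    refine ⟨⟨ht, by linarith⟩, ?_⟩
    have hle : ∀ i, shrink (t / √n) (((1 - t) • x + t • y) i) ^ 2 ≤ (1 - t) ^ 2 * ‖x i‖ ^ 2 := by
      intro i
      rw [Real.norm_eq_abs, sq_abs, ← mul_pow, sq_le_sq]
      refine abs_shrink_le (by positivity) ?_
      have : ((1 - t) • x + t • y) i - (1 - t) * x i = t * y i := by simp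
      rw [this, abs_mul, abs_of_nonneg ht, div_eq_mul_one_div]
      exact mul_le_mul_of_nonneg_left (hy i) ht
    refine (Finset.sum_le_sum fun i _ => hle i).trans ?_
    rw [← Finset.mul_sum, ← EuclideanSpace.norm_sq_eq]
    exact mul_le_of_le_one_right (sq_nonneg _) (pow_le_one₀ (norm_nonneg _) hx)
  · rintro ⟨⟨ht0, ht1⟩, hw⟩
    set t := w (Fin.last n) with ht
    set x : EuclideanSpace ℝ (Fin n) :=
      WithLp.toLp 2 fun i => shrink (t / √n) (w i.castSucc) with hx
    set y : EuclideanSpace ℝ (Fin n) :=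
      WithLp.toLp 2 fun i => w i.castSucc - shrink (t / √n) (w i.castSucc) with hy
    have hxn : ‖x‖ ≤ 1 - t := by
      rw [← sq_le_sq₀ (norm_nonneg _) (by linarith), EuclideanSpace.norm_sq_eq]
      simpa [hx] using hw
    have hyn : ∀ i, |y i| ≤ t / √n := fun i => abs_sub_shrink_le (by positivity) _
    -- When `t = 1` or `t = 0` one of the inverses is the default value 0; the vector it scales, `x`
    -- or `y`, is then zero as well.
    refine ⟨_, ⟨(1 - t)⁻¹ • x, ?_, rfl⟩, _, ⟨t⁻¹ • y, ?_, rfl⟩, 1 - t, t, by linarith, ht0,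
      by ring, ?_⟩
    · rw [mem_closedBall_zero_iff, norm_smul, norm_inv, Real.norm_of_nonneg (by linarith)]
      exact inv_mul_le_one_of_le₀ hxn (by linarith)
    · rw [mem_smul_cube_iff hn]
      intro i
      rw [PiLp.smul_apply, smul_eq_mul, abs_mul, abs_inv, abs_of_nonneg ht0]
      rcases eq_or_lt_of_le ht0 with h | h
      · rw [← h]; simp
      · rw [inv_mul_le_iff₀ h, ← div_eq_mul_one_div]
        exact hyn i
    · simp only [smul_pair_add_smul_pair]
      have h1 : (1 - t) • (1 - t)⁻¹ • x = x := by
        rcases eq_or_lt_of_le ht1 with h | h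
        · have : x = 0 := by rw [h, sub_self] at hxn; simpa using hxn
          simp [this]
        · exact smul_inv_smul₀ (by linarith) _
      have h2 : t • t⁻¹ • y = y := by
        rcases eq_or_lt_of_le ht0 with h | h
        · have : y = 0 := by
            ext i
            have := hyn i
            rw [← h] at this
            simpa using this
          simp [this]
        · exact smul_inv_smul₀ h.ne' _
      rw [h1, h2]
      ext j
      refine Fin.lastCases ?_ (fun j => ?_) j
      · simp [ht]
      · simp [hx, hy]

lemma measurableSet_slices (n : ℕ) : MeasurableSet {p : ℝ × (Fin n → ℝ) | p.1 ∈ Set.Icc (0 : ℝ) 1 ∧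
    ∑ i, shrink (p.1 / √n) (p.2 i) ^ 2 ≤ (1 - p.1) ^ 2} := by
  have hl : Measurable fun p : ℝ × (Fin n → ℝ) => ∑ i, shrink (p.1 / √n) (p.2 i) ^ 2 := by
    refine Finset.measurable_sum _ fun i _ => Measurable.pow_const ?_ _
    have : Measurable fun p : ℝ × (Fin n → ℝ) => (p.1 / √n, p.2 i) := by fun_prop
    exact continuous_shrink.measurable.comp this
  have hr : Measurable fun p : ℝ × (Fin n → ℝ) => (1 - p.1) ^ 2 := by fun_prop
  exact (measurable_fst measurableSet_Icc).inter (measurableSet_le hl hr)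

/-- Splitting off the last coordinate preserves the volume. -/
lemma measurePreserving_splitLast (n : ℕ) : MeasurePreserving
    (fun w : EuclideanSpace ℝ (Fin (n + 1)) =>
      ((w (Fin.last n), fun i : Fin n => w i.castSucc) : ℝ × (Fin n → ℝ))) := by
  have h := (volume_preserving_piFinSuccAbove (fun _ : Fin (n + 1) => ℝ) (Fin.last n)).comp
    (PiLp.volume_preserving_ofLp (Fin (n + 1)))
  convert h using 1
  funext w
  refine Prod.ext rfl (funext fun i => ?_)
  simp [MeasurableEquiv.piFinSuccAbove, Fin.insertNthEquiv, Fin.init]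

lemma W_eq_preimage {n : ℕ} (hn : 1 ≤ n) : W n =
    (fun w : EuclideanSpace ℝ (Fin (n + 1)) =>
      ((w (Fin.last n), fun i : Fin n => w i.castSucc) : ℝ × (Fin n → ℝ))) ⁻¹'
    {p : ℝ × (Fin n → ℝ) | p.1 ∈ Set.Icc (0 : ℝ) 1 ∧
      ∑ i, shrink (p.1 / √n) (p.2 i) ^ 2 ≤ (1 - p.1) ^ 2} := by
  ext w
  exact mem_W_iff hn w

lemma measurableSet_W {n : ℕ} (hn : 1 ≤ n) : MeasurableSet (W n) := by
  rw [W_eq_preimage hn]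
  exact (measurePreserving_splitLast n).measurable (measurableSet_slices n)

open scoped ENNReal in
lemma setLIntegral_W_comp_last {n : ℕ} (hn : 1 ≤ n) {f : ℝ → ℝ≥0∞} (hf : Measurable f) :
    ∫⁻ w in W n, f (w (Fin.last n)) = ∫⁻ t in Set.Icc (0 : ℝ) 1, f t *
      volume {y : Fin n → ℝ | ∑ i, shrink (t / √n) (y i) ^ 2 ≤ (1 - t) ^ 2} := by
  have hm := measurableSet_slices n
  have hfm : Measurable fun p : ℝ × (Fin n → ℝ) => f p.1 := hf.comp measurable_fst
  rw [W_eq_preimage hn, (measurePreserving_splitLast n).setLIntegral_comp_preimage hm hfm,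
    ← lintegral_indicator hm, Measure.volume_eq_prod, lintegral_prod _ (hfm.indicator hm).aemeasurable,
    ← lintegral_indicator measurableSet_Icc]
  refine lintegral_congr fun t => ?_
  by_cases ht : t ∈ Set.Icc (0 : ℝ) 1
  · rw [Set.indicator_of_mem ht, ← setLIntegral_const, ← lintegral_indicator]
    · refine lintegral_congr fun y => ?_
      by_cases hy : ∑ i, shrink (t / √n) (y i) ^ 2 ≤ (1 - t) ^ 2
      · rw [Set.indicator_of_mem (a := (t, y)) (show _ ∧ _ from ⟨ht, hy⟩), Set.indicator_of_mem (by exact hy)]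
      · rw [Set.indicator_of_notMem (fun h => hy h.2), Set.indicator_of_notMem (by exact hy)]
    · exact measurableSet_le (by fun_prop) (by fun_prop)
  · rw [Set.indicator_of_notMem ht]
    refine (lintegral_congr fun y => ?_).trans lintegral_zero
    exact Set.indicator_of_notMem (fun h => ht h.1) _

/-- The normalised mixed volumes of the ball and the cube of radius `1 / √n`. -/
noncomputable def mixedCoeff (n k : ℕ) : ℝ := (2 / √n) ^ k * ballVolume (n - k)

lemma mixedCoeff_nonneg (n k : ℕ) : 0 ≤ mixedCoeff n k :=
  mul_nonneg (by positivity) (ballVolume_pos _).le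

/-- The Steiner formula with `r = t/√n` and `R = 1 - t` leaves one Beta integral per `k`. The cases
`p = 0` and `p = 1` give the volume and the first moment. -/
lemma setLIntegral_W_pow {n : ℕ} (hn : 1 ≤ n) (p : ℕ) :
    ∫⁻ w in W n, ENNReal.ofReal (w (Fin.last n) ^ p) =
      ENNReal.ofReal (∑ k ∈ Finset.range (n + 1), mixedCoeff n k *
        (n.choose k * ((k + p).factorial * (n - k).factorial / (n + p + 1).factorial))) := by
  rw [setLIntegral_W_comp_last hn (f := fun t => ENNReal.ofReal (t ^ p)) (by fun_prop)]
  set F : ℝ → ℝ := fun t => ∑ k ∈ Finset.range (n + 1), mixedCoeff n k *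
    (n.choose k * (t ^ (k + p) * (1 - t) ^ (n - k))) with hF
  have h1 : ∀ t ∈ Set.Icc (0 : ℝ) 1, ENNReal.ofReal (t ^ p) *
      volume {y : Fin n → ℝ | ∑ i, shrink (t / √n) (y i) ^ 2 ≤ (1 - t) ^ 2} =
        ENNReal.ofReal (F t) := by
    rintro t ⟨ht0, ht1⟩
    rw [volume_sum_shrink_le_sq (by positivity) (by linarith), ← ENNReal.ofReal_mul (by positivity),
      Finset.Nat.sum_antidiagonal_eq_sum_range_succ
        (fun i j => (n.choose i : ℝ) * ((2 * (t / √n)) ^ i * (ballVolume j * (1 - t) ^ j))),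
      Finset.mul_sum]
    congr 1
    refine Finset.sum_congr rfl fun k _ => ?_
    rw [mixedCoeff, show 2 * (t / √n) = 2 / √n * t by ring, mul_pow, pow_add]
    ring
  have hcont : Continuous F := by fun_prop
  rw [setLIntegral_congr_fun measurableSet_Icc h1, ← ofReal_integral_eq_lintegral_ofReal]
  · congr 1
    rw [integral_Icc_eq_integral_Ioc, ← intervalIntegral.integral_of_le zero_le_one, hF,
      intervalIntegral.integral_finsetSum fun k _ => Continuous.intervalIntegrable (by fun_prop) _ _]
    refine Finset.sum_congr rfl fun k hk => ?_
    rw [intervalIntegral.integral_const_mul, intervalIntegral.integral_const_mul,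
      integral_pow_mul_one_sub_pow]
    have hk' := Finset.mem_range_succ_iff.1 hk
    rw [show k + p + (n - k) + 1 = n + p + 1 by omega]
  · exact hcont.integrableOn_Icc
  · filter_upwards [ae_restrict_mem measurableSet_Icc] with t ht
    refine Finset.sum_nonneg fun k _ => mul_nonneg (mixedCoeff_nonneg n k) ?_
    have h0 := ht.1
    have h1 : 0 ≤ 1 - t := by linarith [ht.2]
    positivity

/-- This cancellation gives every mixed coefficient the same weight in the volume. -/
lemma choose_mul_factorial_div {n k : ℕ} (hk : k ≤ n) :
    (n.choose k * (k.factorial * (n - k).factorial / (n + 1).factorial) : ℝ) = 1 / (n + 1) := by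
  have h : ((n + 1).factorial : ℝ) = (n + 1) * (n.choose k * k.factorial * (n - k).factorial) := by
    rw [Nat.factorial_succ, ← Nat.choose_mul_factorial_mul_factorial hk]
    push_cast
    ring
  have h1 : (n.choose k : ℝ) ≠ 0 := Nat.cast_ne_zero.2 (Nat.choose_pos hk).ne'
  have h2 : (k.factorial : ℝ) ≠ 0 := Nat.cast_ne_zero.2 k.factorial_ne_zero
  have h3 : ((n - k).factorial : ℝ) ≠ 0 := Nat.cast_ne_zero.2 (n - k).factorial_ne_zero
  rw [h]
  field_simp

lemma volume_W {n : ℕ} (hn : 1 ≤ n) :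
    volume (W n) = ENNReal.ofReal ((∑ k ∈ Finset.range (n + 1), mixedCoeff n k) / (n + 1)) := by
  have h := setLIntegral_W_pow hn 0
  simp only [pow_zero, ENNReal.ofReal_one, setLIntegral_one, add_zero] at h
  rw [h, Finset.sum_div]
  congr 1
  refine Finset.sum_congr rfl fun k hk => ?_
  rw [choose_mul_factorial_div (Finset.mem_range_succ_iff.1 hk), mul_one_div]

lemma isBounded_W {n : ℕ} (hn : 1 ≤ n) : Bornology.IsBounded (W n) := by
  refine Bornology.IsBounded.subset ?_ (W_subset_loewner hn)
  have hc : Continuous fun x => (1 / 2 : ℝ) • eLast n + loewnerMap hn x :=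
    continuous_const.add (loewnerMap hn).toLinearMap.continuous_of_finiteDimensional
  exact ((isCompact_closedBall _ _).image hc).isBounded

lemma integrableOn_W {n : ℕ} (hn : 1 ≤ n) :
    IntegrableOn (fun x : EuclideanSpace ℝ (Fin (n + 1)) => x) (W n) := by
  obtain ⟨C, hC⟩ := (isBounded_W hn).exists_norm_le
  refine Measure.integrableOn_of_bounded (M := C) (isBounded_W hn).measure_lt_top.ne
    (by fun_prop) ?_
  filter_upwards [ae_restrict_mem (measurableSet_W hn)] with x hx using hC x hx

lemma setIntegral_W_apply {n : ℕ} (hn : 1 ≤ n) (i : Fin (n + 1)) :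
    (∫ x in W n, x) i = ∫ x in W n, x i :=
  ((EuclideanSpace.proj (𝕜 := ℝ) i).integral_comp_comm (integrableOn_W hn)).symm

lemma setIntegral_W_last {n : ℕ} (hn : 1 ≤ n) :
    ∫ x in W n, x (Fin.last n) =
      (∑ k ∈ Finset.range (n + 1), (k + 1) * mixedCoeff n k) / ((n + 1) * (n + 2)) := by
  have h := setLIntegral_W_pow hn 1
  simp only [pow_one] at h
  rw [integral_eq_lintegral_of_nonneg_ae, h, ENNReal.toReal_ofReal, Finset.sum_div]
  · refine Finset.sum_congr rfl fun k hk => ?_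
    have h1 := choose_mul_factorial_div (Finset.mem_range_succ_iff.1 hk)
    have h2 : (n.choose k * ((k + 1).factorial * (n - k).factorial / (n + 1 + 1).factorial) : ℝ) =
        (k + 1) / (n + 2) *
          (n.choose k * (k.factorial * (n - k).factorial / (n + 1).factorial)) := by
      rw [Nat.factorial_succ k, Nat.factorial_succ (n + 1)]
      push_cast
      field_simp
      ring
    rw [h2, h1]
    field_simp
  · exact Finset.sum_nonneg fun k _ => mul_nonneg (mixedCoeff_nonneg n k) (by positivity)
  · filter_upwards [ae_restrict_mem (measurableSet_W hn)] with w hw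
    exact ((mem_W_iff hn w).1 hw).1.1
  · fun_prop

lemma centroid_W_last {n : ℕ} (hn : 1 ≤ n) :
    centroid (W n) (Fin.last n) =
      (∑ k ∈ Finset.range (n + 1), (k + 1) * mixedCoeff n k) /
        (∑ k ∈ Finset.range (n + 1), mixedCoeff n k) / (n + 2) := by
  rw [centroid, PiLp.smul_apply, setIntegral_W_apply hn, setIntegral_W_last hn, Measure.real,
    volume_W hn, ENNReal.toReal_ofReal
      (div_nonneg (Finset.sum_nonneg fun k _ => mixedCoeff_nonneg n k) (by positivity)),
    smul_eq_mul]
  field_simp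

lemma shrink_neg {r : ℝ} (hr : 0 ≤ r) (x : ℝ) : shrink r (-x) = -shrink r x := by
  rcases lt_or_ge x (-r) with h | h
  · rw [shrink_of_lt_neg hr h, shrink_of_lt hr (by linarith)]; ring
  rcases lt_or_ge r x with h' | h'
  · rw [shrink_of_lt_neg hr (by linarith), shrink_of_lt hr h']; ring
  rw [shrink_of_abs_le (abs_le.2 ⟨h, h'⟩), shrink_of_abs_le (abs_le.2 ⟨by linarith, by linarith⟩),
    neg_zero]

/-- Reflection in the last coordinate axis. -/
noncomputable def reflect (n : ℕ) :
    EuclideanSpace ℝ (Fin (n + 1)) ≃ₗᵢ[ℝ] EuclideanSpace ℝ (Fin (n + 1)) :=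
  LinearIsometryEquiv.piLpCongrRight 2
    (Fin.snoc (α := fun _ => ℝ ≃ₗᵢ[ℝ] ℝ) (fun _ => LinearIsometryEquiv.neg ℝ)
      (LinearIsometryEquiv.refl ℝ ℝ))

lemma reflect_castSucc {n : ℕ} (w : EuclideanSpace ℝ (Fin (n + 1))) (i : Fin n) :
    reflect n w i.castSucc = -w i.castSucc := by
  simp [reflect]

lemma reflect_last {n : ℕ} (w : EuclideanSpace ℝ (Fin (n + 1))) :
    reflect n w (Fin.last n) = w (Fin.last n) := by
  simp [reflect]

lemma reflect_preimage_W {n : ℕ} (hn : 1 ≤ n) : reflect n ⁻¹' W n = W n := by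
  ext w
  rw [Set.mem_preimage, mem_W_iff hn, mem_W_iff hn, reflect_last]
  refine and_congr_right fun h => ?_
  have : 0 ≤ w (Fin.last n) / √n := div_nonneg h.1 (Real.sqrt_nonneg _)
  simp [reflect_castSucc, shrink_neg this]

/-- The reflection preserves `W n` and volume but negates the integrand. -/
lemma setIntegral_W_castSucc {n : ℕ} (hn : 1 ≤ n) (i : Fin n) :
    ∫ x in W n, x i.castSucc = 0 := by
  have h := (reflect n).measurePreserving.setIntegral_preimage_emb
    (reflect n).toHomeomorph.measurableEmbedding (fun x => x i.castSucc) (W n)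
  rw [reflect_preimage_W hn] at h
  simp only [reflect_castSucc, integral_neg] at h
  linarith

lemma centroid_W_eq {n : ℕ} (hn : 1 ≤ n) :
    centroid (W n) = centroid (W n) (Fin.last n) • eLast n := by
  ext j
  refine Fin.lastCases ?_ (fun j => ?_) j
  · simp [eLast]
  · have : centroid (W n) j.castSucc = 0 := by
      rw [centroid, PiLp.smul_apply, setIntegral_W_apply hn, setIntegral_W_castSucc hn, smul_zero]
    simp [this, eLast, Fin.castSucc_ne_last]

/-! ### Asymptotics of the centroid -/

/-- Log-convexity of Gamma at the midpoint of `x` and `x + 1`. -/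
lemma Gamma_add_half_sq_le {x : ℝ} (hx : 0 < x) :
    Real.Gamma (x + 1 / 2) ^ 2 ≤ x * Real.Gamma x ^ 2 := by
  have h := Real.Gamma_mul_add_mul_le_rpow_Gamma_mul_rpow_Gamma hx (by linarith : 0 < x + 1)
    one_half_pos one_half_pos (by norm_num)
  have hG := (Real.Gamma_pos_of_pos hx).le
  rw [show 1 / 2 * x + 1 / 2 * (x + 1) = x + 1 / 2 by ring, ← Real.sqrt_eq_rpow,
    ← Real.sqrt_eq_rpow, ← Real.sqrt_mul hG, Real.Gamma_add_one hx.ne'] at h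
  calc Real.Gamma (x + 1 / 2) ^ 2 ≤ √(Real.Gamma x * (x * Real.Gamma x)) ^ 2 :=
        pow_le_pow_left₀ (Real.Gamma_pos_of_pos (by positivity)).le h 2
    _ = x * Real.Gamma x ^ 2 := by rw [Real.sq_sqrt (by positivity)]; ring

/-- The upper bound at `x - 1/2`, turned around by the functional equation. -/
lemma le_Gamma_add_half_sq {x : ℝ} (hx : 1 / 2 < x) :
    (x - 1 / 2) * Real.Gamma x ^ 2 ≤ Real.Gamma (x + 1 / 2) ^ 2 := by
  have hy : 0 < x - 1 / 2 := by linarith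
  have h := Gamma_add_half_sq_le hy
  rw [sub_add_cancel] at h
  have h2 : Real.Gamma (x + 1 / 2) = (x - 1 / 2) * Real.Gamma (x - 1 / 2) := by
    rw [← Real.Gamma_add_one hy.ne']
    ring_nf
  rw [h2, mul_pow, sq (x - 1 / 2), mul_assoc]
  exact mul_le_mul_of_nonneg_left h hy.le

lemma ballVolume_div_sq (m : ℕ) : (ballVolume m / ballVolume (m + 1)) ^ 2 =
    Real.Gamma ((m / 2 + 1 : ℝ) + 1 / 2) ^ 2 / Real.Gamma (m / 2 + 1) ^ 2 / Real.pi := by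
  have h1 : 0 < Real.Gamma (m / 2 + 1) := Real.Gamma_pos_of_pos (by positivity)
  have h2 : 0 < Real.Gamma ((m / 2 + 1 : ℝ) + 1 / 2) := Real.Gamma_pos_of_pos (by positivity)
  have h3 := Real.pi_pos
  have h4 : 0 < √Real.pi := Real.sqrt_pos.2 h3
  have h5 : √Real.pi ^ 2 = Real.pi := Real.sq_sqrt h3.le
  rw [ballVolume, ballVolume, show (((m + 1 : ℕ) : ℝ) / 2 + 1) = (m / 2 + 1 : ℝ) + 1 / 2 by
    push_cast; ring]
  generalize √Real.pi = s at h4 h5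
  rw [← h5]
  field_simp
  ring

lemma ballVolume_div_sq_le (m : ℕ) :
    (ballVolume m / ballVolume (m + 1)) ^ 2 ≤ (m + 2) / (2 * Real.pi) := by
  have h1 : 0 < Real.Gamma (m / 2 + 1) := Real.Gamma_pos_of_pos (by positivity)
  have h3 := Real.pi_pos
  rw [ballVolume_div_sq, div_div, div_le_iff₀ (by positivity)]
  refine (Gamma_add_half_sq_le (by positivity)).trans_eq ?_
  field_simp

lemma le_ballVolume_div_sq (m : ℕ) :
    (m + 1) / (2 * Real.pi) ≤ (ballVolume m / ballVolume (m + 1)) ^ 2 := by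
  have h1 : 0 < Real.Gamma (m / 2 + 1) := Real.Gamma_pos_of_pos (by positivity)
  have h3 := Real.pi_pos
  have h4 : (0 : ℝ) ≤ m / 2 := by positivity
  rw [ballVolume_div_sq, div_div, le_div_iff₀ (by positivity)]
  refine Eq.trans_le ?_ (le_Gamma_add_half_sq (by linarith))
  field_simp
  ring

/-- The coefficients `mixedCoeff n k`, divided by the volume of the ball and extended by zero. -/
noncomputable def normCoeff (n k : ℕ) : ℝ := if k ≤ n then mixedCoeff n k / ballVolume n else 0

lemma normCoeff_nonneg (n k : ℕ) : 0 ≤ normCoeff n k := by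
  unfold normCoeff
  split_ifs
  · exact div_nonneg (mixedCoeff_nonneg n k) (ballVolume_pos n).le
  · exact le_rfl

lemma normCoeff_zero (n : ℕ) : normCoeff n 0 = 1 := by
  simp [normCoeff, mixedCoeff, (ballVolume_pos n).ne']

/-- The quotient of consecutive coefficients. -/
noncomputable def coeffRatio (n k : ℕ) : ℝ :=
  2 / √n * (ballVolume (n - k - 1) / ballVolume (n - k - 1 + 1))

lemma coeffRatio_nonneg (n k : ℕ) : 0 ≤ coeffRatio n k := by
  have h1 := ballVolume_pos (n - k - 1)
  have h2 := ballVolume_pos (n - k - 1 + 1)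
  unfold coeffRatio
  positivity

lemma normCoeff_succ {n k : ℕ} (hk : k < n) :
    normCoeff n (k + 1) = coeffRatio n k * normCoeff n k := by
  have h1 : n - k = n - k - 1 + 1 := by omega
  rw [normCoeff, normCoeff, if_pos (Nat.succ_le_of_lt hk), if_pos hk.le, mixedCoeff, mixedCoeff, coeffRatio, pow_succ,
    ← Nat.sub_sub, h1, Nat.add_sub_cancel]
  have h2 := (ballVolume_pos (n - k - 1 + 1)).ne'
  field_simp

/-- For fixed `k` both bounds tend to `2/π`, the source of the constant in the theorem; the upper
one also gives a uniform bound below 1. -/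
lemma coeffRatio_sq_bounds {n k : ℕ} (hk : k < n) :
    2 / Real.pi * ((n - k) / n) ≤ coeffRatio n k ^ 2 ∧
      coeffRatio n k ^ 2 ≤ 2 / Real.pi * ((n - k + 1) / n) := by
  have hn : (0 : ℝ) < n := by exact_mod_cast (Nat.zero_le k).trans_lt hk
  have hpi := Real.pi_pos
  have hc : ((n - k - 1 : ℕ) : ℝ) = n - k - 1 := by
    rw [Nat.sub_sub, Nat.cast_sub (by omega)]
    push_cast
    ring
  have h : coeffRatio n k ^ 2 =
      4 / n * (ballVolume (n - k - 1) / ballVolume (n - k - 1 + 1)) ^ 2 := by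
    rw [coeffRatio, mul_pow, div_pow, Real.sq_sqrt hn.le]
    norm_num
  have hu := ballVolume_div_sq_le (n - k - 1)
  have hl := le_ballVolume_div_sq (n - k - 1)
  rw [hc] at hu hl
  have h4 : (0 : ℝ) ≤ 4 / n := by positivity
  rw [h]
  constructor
  · refine Eq.trans_le ?_ (mul_le_mul_of_nonneg_left hl h4)
    field_simp
    ring
  · refine (mul_le_mul_of_nonneg_left hu h4).trans_eq ?_
    field_simp
    ring

lemma tendsto_coeffRatio (k : ℕ) :
    Tendsto (fun n => coeffRatio n k) atTop (𝓝 √(2 / Real.pi)) := by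
  have hlim : ∀ c : ℝ, Tendsto (fun n : ℕ => 2 / Real.pi * ((n - c) / n)) atTop
      (𝓝 (2 / Real.pi)) := by
    intro c
    have h : Tendsto (fun n : ℕ => 2 / Real.pi * (1 - c / n)) atTop
        (𝓝 (2 / Real.pi * (1 - 0))) :=
      (tendsto_const_nhds.sub (tendsto_const_div_atTop_nhds_zero_nat c)).const_mul _
    rw [sub_zero, mul_one] at h
    refine h.congr' ?_
    filter_upwards [eventually_gt_atTop 0] with n hn
    have : (n : ℝ) ≠ 0 := by positivity
    field_simp
  have hsq : Tendsto (fun n => coeffRatio n k ^ 2) atTop (𝓝 (2 / Real.pi)) := by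
    refine tendsto_of_tendsto_of_tendsto_of_le_of_le' (hlim k) (hlim (k - 1)) ?_ ?_
    · filter_upwards [eventually_gt_atTop k] with n hn using (coeffRatio_sq_bounds hn).1
    · filter_upwards [eventually_gt_atTop k] with n hn
      rw [← sub_add]
      exact (coeffRatio_sq_bounds hn).2
  refine hsq.sqrt.congr fun n => Real.sqrt_sq (coeffRatio_nonneg n k)

lemma tendsto_normCoeff (k : ℕ) :
    Tendsto (fun n => normCoeff n k) atTop (𝓝 (√(2 / Real.pi) ^ k)) := by
  induction k with
  | zero => simp [normCoeff_zero]
  | succ k ih =>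
    rw [pow_succ']
    refine ((tendsto_coeffRatio k).mul ih).congr' ?_
    filter_upwards [eventually_gt_atTop k] with n hn using (normCoeff_succ hn).symm

lemma coeffRatio_le {n k : ℕ} (hn : 10 ≤ n) (hk : k < n) : coeffRatio n k ≤ 9 / 10 := by
  have hn' : (10 : ℝ) ≤ n := by exact_mod_cast hn
  refine (sq_le_sq₀ (coeffRatio_nonneg n k) (by norm_num)).1 ?_
  refine (coeffRatio_sq_bounds hk).2.trans ?_
  have h1 : (n - k + 1 : ℝ) / n ≤ 11 / 10 := by
    rw [div_le_div_iff₀ (by positivity) (by norm_num)]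
    have : (0 : ℝ) ≤ k := by positivity
    linarith
  have h2 : 2 / Real.pi ≤ 2 / 3 := div_le_div_of_nonneg_left (by norm_num) (by norm_num)
    Real.pi_gt_three.le
  have h3 : (0 : ℝ) ≤ 2 / Real.pi := by have := Real.pi_pos; positivity
  -- Any constant below 1 whose square is at least `(2/3)(11/10) = 11/15` would serve in place of
  -- `9/10`.
  calc 2 / Real.pi * ((n - k + 1) / n) ≤ 2 / Real.pi * (11 / 10) :=
        mul_le_mul_of_nonneg_left h1 h3
    _ ≤ (9 / 10) ^ 2 := by linarith

lemma normCoeff_le {n : ℕ} (hn : 10 ≤ n) (k : ℕ) : normCoeff n k ≤ (9 / 10) ^ k := by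
  induction k with
  | zero => simp [normCoeff_zero]
  | succ k ih =>
    rcases lt_or_ge k n with hk | hk
    · rw [normCoeff_succ hk, pow_succ']
      exact mul_le_mul (coeffRatio_le hn hk) ih (normCoeff_nonneg _ _) (by norm_num)
    · rw [normCoeff, if_neg (by omega)]
      positivity

lemma sqrt_two_div_pi_lt_one : √(2 / Real.pi) < 1 := by
  rw [Real.sqrt_lt' one_pos, one_pow, div_lt_one Real.pi_pos]
  linarith [Real.pi_gt_three]

lemma tsum_mul_normCoeff (n : ℕ) (c : ℕ → ℝ) : ∑' k, c k * normCoeff n k =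
    (∑ k ∈ Finset.range (n + 1), c k * mixedCoeff n k) / ballVolume n := by
  rw [tsum_eq_sum (s := Finset.range (n + 1)), Finset.sum_div]
  · refine Finset.sum_congr rfl fun k hk => ?_
    rw [normCoeff, if_pos (Finset.mem_range_succ_iff.1 hk), mul_div_assoc]
  · intro k hk
    rw [normCoeff, if_neg (fun h => hk (Finset.mem_range_succ_iff.2 h)), mul_zero]

/-- Dominated convergence for series; extending the coefficients by zero puts all `n` on one index
set. It is used with `c k = 1` and `c k = k + 1`. -/
lemma tendsto_tsum_mul_normCoeff {c : ℕ → ℝ} (hc : ∀ k, 0 ≤ c k)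
    (hs : Summable fun k => c k * (9 / 10 : ℝ) ^ k) :
    Tendsto (fun n => ∑' k, c k * normCoeff n k) atTop (𝓝 (∑' k, c k * √(2 / Real.pi) ^ k)) := by
  refine tendsto_tsum_of_dominated_convergence hs
    (fun k => (tendsto_normCoeff k).const_mul (c k)) ?_
  filter_upwards [eventually_ge_atTop 10] with n hn k
  rw [Real.norm_of_nonneg (mul_nonneg (hc k) (normCoeff_nonneg n k))]
  exact mul_le_mul_of_nonneg_left (normCoeff_le hn k) (hc k)

lemma hasSum_succ_mul_pow {r : ℝ} (hr0 : 0 ≤ r) (hr : r < 1) :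
    HasSum (fun k : ℕ => (k + 1) * r ^ k) (1 / (1 - r) ^ 2) := by
  have hn : ‖r‖ < 1 := by rwa [Real.norm_of_nonneg hr0]
  have h := (hasSum_coe_mul_geometric_of_norm_lt_one hn).add (hasSum_geometric_of_lt_one hr0 hr)
  have h1 : 1 - r ≠ 0 := by linarith
  have h2 : r / (1 - r) ^ 2 + (1 - r)⁻¹ = 1 / (1 - r) ^ 2 := by
    field_simp
    ring
  rw [h2] at h
  simpa only [add_mul, one_mul] using h

lemma tendsto_mul_centroid_W_last :
    Tendsto (fun n : ℕ => n * centroid (W n) (Fin.last n)) atTop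
      (𝓝 (1 / (1 - √(2 / Real.pi)))) := by
  set q := √(2 / Real.pi) with hq
  have hq0 : 0 ≤ q := Real.sqrt_nonneg _
  have hq1 : q < 1 := sqrt_two_div_pi_lt_one
  have hq2 : 1 - q ≠ 0 := by linarith
  have h0 := tendsto_tsum_mul_normCoeff (c := fun _ => 1) (fun _ => zero_le_one)
    (by simpa using summable_geometric_of_lt_one (by norm_num) (by norm_num : (9 / 10 : ℝ) < 1))
  have h1 := tendsto_tsum_mul_normCoeff (c := fun k => (k : ℝ) + 1) (fun k => by positivity)
    (hasSum_succ_mul_pow (by norm_num) (by norm_num : (9 / 10 : ℝ) < 1)).summable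
  rw [← hq, (hasSum_succ_mul_pow hq0 hq1).tsum_eq] at h1
  simp only [← hq, one_mul, tsum_geometric_of_lt_one hq0 hq1] at h0
  have h2 : Tendsto (fun n : ℕ => (n : ℝ) / (n + 2)) atTop (𝓝 1) :=
    tendsto_natCast_div_add_atTop 2
  -- The ball volume normalising numerator and denominator cancels in the quotient.
  have h := h2.mul (h1.div h0 (inv_ne_zero hq2))
  have hval : 1 * (1 / (1 - q) ^ 2 / (1 - q)⁻¹) = 1 / (1 - q) := by field_simp
  rw [hval] at h
  refine h.congr' ?_
  filter_upwards [eventually_ge_atTop 1] with n hn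
  have e0 := tsum_mul_normCoeff n fun _ => 1
  simp only [one_mul] at e0
  rw [Pi.div_apply, e0, tsum_mul_normCoeff n fun k => (k : ℝ) + 1,
    div_div_div_cancel_right₀ (ballVolume_pos n).ne', centroid_W_last hn]
  ring

lemma isLittleO_centroid_W_last :
    (fun n : ℕ => centroid (W n) (Fin.last n) - 1 / (n : ℝ) * (1 / (1 - √(2 / Real.pi))))
      =o[atTop] fun n : ℕ => 1 / (n : ℝ) := by
  rw [Asymptotics.isLittleO_iff_tendsto']
  · have h := tendsto_mul_centroid_W_last.sub_const (1 / (1 - √(2 / Real.pi)))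
    rw [sub_self] at h
    refine h.congr' ?_
    filter_upwards [eventually_gt_atTop 0] with n hn
    have : (n : ℝ) ≠ 0 := by positivity
    generalize 1 / (1 - √(2 / Real.pi)) = a
    field_simp
  · filter_upwards [eventually_gt_atTop 0] with n hn h
    have : (n : ℝ) ≠ 0 := by positivity
    simp [this] at h

end AffinePoints

theorem mainTheorem7 :
    (∀ n : ℕ, 1 ≤ n →
      (∃! L, AffinePoints.IsLoewnerEllipsoid (AffinePoints.W n) L) ∧
      (∀ c, AffinePoints.IsLoewnerCentre (AffinePoints.W n) c ↔
        c = (1 / 2 : ℝ) • AffinePoints.eLast n) ∧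
      AffinePoints.centroid (AffinePoints.W n) =
        AffinePoints.centroid (AffinePoints.W n) (Fin.last n) • AffinePoints.eLast n) ∧
    Asymptotics.IsLittleO Filter.atTop
      (fun n : ℕ => AffinePoints.centroid (AffinePoints.W n) (Fin.last n) -
        1 / (n : ℝ) * (1 / (1 - √(2 / Real.pi))))
      (fun n : ℕ => 1 / (n : ℝ)) :=
  ⟨fun _ hn => ⟨AffinePoints.existsUnique_isLoewnerEllipsoid hn,
    AffinePoints.isLoewnerCentre_iff hn, AffinePoints.centroid_W_eq hn⟩,
    AffinePoints.isLittleO_centroid_W_last⟩
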